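/- **Setting.** Let $\mathfrak g$ be a complex simple Lie algebra with a magical $\mathfrak{sl}_2$-triple $\{f,h,e\}$. That is, the linear map $\sigma$ which is the identity on $W(0)$ and $(-1)^{i+1}$ on $W(k)_{k-2i}$ ($k>0$, $0\le i\le k$) is a Lie algebra homomorphism; here $W(k)\subset\mathfrak g$ is the sum of the irreducible $\langle f,h,e\rangle$-submodules of highest weight $k$, and $W(k)_l$ is its $l$-eigenspace under $\mathrm{ad}_h$. Let $\mathfrak h,\mathfrak m$ be the $\pm1$-eigenspaces of $\sigma$. Let $\tau$ be a real form commuting with $\sigma$ such that $\tau(h)=-h$, $\tau(e)=f$, $\tau(f)=e$ and $\rho=\tau\sigma$ is a compact real form. Put $\mathfrak c=W(0)$, $V_{k}=W(k)_{k}$, $Z_{2m}=W(2m)_0$, $\mathfrak g_0=\ker \mathrm{ad}_h$ and $\mathfrak g_0^s=[\mathfrak g_0,\mathfrak g_0]$, let $\theta$ be $+1$ on $\mathfrak c$ and $-1$ on $\bigoplus_{m>0}Z_{2m}$, and let $\mathfrak m_{\mathcal C}$ be the $-1$-eigenspace of $\theta$ in $\mathfrak g_0^s$. Let $m_{\mathcal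 C}>0$ be the integer with $\mathfrak m_{\mathcal C}\subset Z_{2m_{\mathcal C}}$ (any positive integer if $\mathfrak m_{\mathcal C}=0$). Let $G$ be a complex Lie group with Lie algebra $\mathfrak g$, realized as a closed subgroup of $\mathrm{GL}_N(\mathbb C)$ with $\rho(Y)=-Y^*$ on $\mathfrak g$. Let $G^{\mathbb R}$ and $G_{\mathcal C}^{\mathbb R,s}$ be closed subgroups of $G$ with Lie algebras $\mathfrak g^\tau$ and $(\mathfrak g_0^s)^{\theta\rho}$ which have Cartan decompositions with maximal compact subgroups $H^{\mathbb R}=G^{\mathbb R}\cap \mathrm U(N)$ and $C^{\mathbb R}=G_{\mathcal C}^{\mathbb R,s}\cap \mathrm U(N)$. Let $H\subset G$ and $C\subset H$ be the complexifications of $H^{\mathbb R}$ and $C^{\mathbb R}$, with Lie algebras $\mathfrak h$ and $\mathfrak c$, and suppose that $C$ fixes $f,h,e$ under the adjoint action. Let $X$ be a compact connected Riemann surface with canonical bundle $K$ and a theta characteristic $K^{1/2}$. A *Cayley uniformizing Higgs bundle* $(\mathcal P_H,\Phi_0)$ is given by a holomorphic principal $C$-bundle $\mathcal P_C$, a holomorphic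 section $f_{\mathcal C}$ of $\mathcal P_C(\mathfrak m_{\mathcal C})\otimes K^{m_{\mathcal C}+1}$, and a semisimple holomorphic section $h_{\mathcal C}$ of $\mathcal P_C(\mathfrak c)$ with $[h_{\mathcal C},f_{\mathcal C}]=-2f_{\mathcal C}$ (so that $(\mathcal P_C,f_{\mathcal C})\cong(\mathcal P_C,\lambda f_{\mathcal C})$ for all $\lambda\in\mathbb C^*$). Namely, $\mathcal P_H$ is the $H$-bundle obtained from $\mathcal P_C\times_X\mathcal P_{K^{1/2}}$ through $C\times\mathbb C^*\to H$, $(c,e^{s})\mapsto c\exp(sh)$, where $\mathcal P_{K^{1/2}}$ is the frame bundle of $K^{1/2}$, and $\Phi_0=(f+\tilde f_{\mathcal C})\,dz\in H^0(\mathcal P_H(\mathfrak m)\otimes K)$, where $\tilde f_{\mathcal C}$ takes values in $V_{2m_{\mathcal C}}$ and $\mathrm{ad}_f^{m_{\mathcal C}}(\tilde f_{\mathcal C})=f_{\mathcal C}$. Its *grading element* is the holomorphic section $h_0=h+(m_{\mathcal C}+1)h_{\mathcal C}$ of $\mathcal P_H(\mathfrak h)$. A smooth reduction $\mathcal Q$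 of $\mathcal P_H$ to $H^{\mathbb R}$ induces an antilinear involution $\rho_{\mathcal Q}$ of $\mathcal P_H(\mathfrak g)$, equal to $\rho$ in the frames of $\mathcal Q$, and the Chern connection $D_{\mathcal Q}=\bar\partial_{\mathcal P_H}+\rho_{\mathcal Q}\circ\bar\partial_{\mathcal P_H}\circ\rho_{\mathcal Q}$ with curvature $F_{D_{\mathcal Q}}$. For $R>0$, $\mathcal Q$ is a *harmonic reduction with parameter $R$* if $F_{D_{\mathcal Q}}-R^2[\Phi_0,\rho_{\mathcal Q}(\Phi_0)]=0$. We write $h_0\in H^0(\mathcal P_H(i\mathfrak h^{\mathbb R}))$ with respect to $\mathcal Q$ if $\rho_{\mathcal Q}(h_0)=-h_0$. **Proposition.** Let $(\mathcal P_H,\Phi_0)$ be a Cayley uniformizing Higgs bundle with grading element $h_0$, let $\mathcal Q_0$ be a harmonic reduction with parameter $1$, and let $R>0$. 1. If $h_0\in H^0(\mathcal P_H(i\mathfrak h^{\mathbb R}))$ with respect to $\mathcal Q_0$, then there is exactly one reduction $\mathcal Q_0(R)$ of $\mathcal P_H$ to $H^{\mathbb R}$ with $$\rho_{\mathcal Q_0(R)}=R^{-h_0}\circ\rho_{\mathcal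 Q_0},\qquad R^{-h_0}:=\mathrm{Ad}(\exp(-\log(R)\,h_0)),$$ and $\mathcal Q_0(R)$ is a harmonic reduction with parameter $R$. 2. If $\mathcal Q_0$ is the only harmonic reduction with parameter $1$, then the condition $h_0\in H^0(\mathcal P_H(i\mathfrak h^{\mathbb R}))$ with respect to $\mathcal Q_0$ holds automatically, and $\mathcal Q_0(R)$ is the only harmonic reduction with parameter $R$. -/

import Mathlib

open scoped Manifold ContDiff Topology

attribute [local instance 100] LieRing.ofAssociativeRing

noncomputable section

namespace CayleyHiggs

/-! ### Linear groups and their Lie algebras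

All complex groups are realized as closed subgroups of `GL_N(ℂ)`, the units of the algebra
`Op N` of linear operators of the Hermitian space `ℂ^N`; the Lie bracket is the commutator. -/

/-- The linear operators of the Hermitian space `ℂ^N`; `star` is the adjoint. -/
def Op (N : ℕ) : Type := EuclideanSpace ℂ (Fin N) →L[ℂ] EuclideanSpace ℂ (Fin N)

instance (N : ℕ) : CStarAlgebra (Op N) :=
  inferInstanceAs (CStarAlgebra (EuclideanSpace ℂ (Fin N) →L[ℂ] EuclideanSpace ℂ (Fin N)))

instance (N : ℕ) : FiniteDimensional ℂ (Op N) :=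
  inferInstanceAs
    (FiniteDimensional ℂ (EuclideanSpace ℂ (Fin N) →L[ℂ] EuclideanSpace ℂ (Fin N)))

variable {N : ℕ}

/-- `exp X` as an element of `GL_N(ℂ)`. -/
def expU (X : Op N) : (Op N)ˣ where
  val := NormedSpace.exp X
  inv := NormedSpace.exp (-X)
  val_inv := by
    let _ : NormedAlgebra ℚ (Op N) := NormedAlgebra.restrictScalars ℚ ℂ (Op N)
    rw [← NormedSpace.exp_add_of_commute ((Commute.refl X).neg_right)]
    simp
  inv_val := by
    let _ : NormedAlgebra ℚ (Op N) := NormedAlgebra.restrictScalars ℚ ℂ (Op N)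
    rw [← NormedSpace.exp_add_of_commute ((Commute.refl X).neg_left)]
    simp

/-- The adjoint action `Ad(a) X = a X a⁻¹`. -/
def Ad (a : (Op N)ˣ) (X : Op N) : Op N := (a : Op N) * X * ((a⁻¹ : (Op N)ˣ) : Op N)

/-- The unitary group `U(N)` inside `GL_N(ℂ)`. -/
def unitaryGroup (N : ℕ) : Subgroup (Op N)ˣ := (Unitary.toUnits (R := Op N)).range

/-- `S` is the Lie algebra of the linear group `K`: it consists of the `X` all of whose
one-parameter subgroups `exp(tX)`, `t ∈ ℝ`, lie in `K`. -/
def HasLieAlgebra (K : Subgroup (Op N)ˣ) (S : Set (Op N)) : Prop :=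
  ∀ X : Op N, X ∈ S ↔ ∀ t : ℝ, expU ((t : ℂ) • X) ∈ K

/-! ### `𝔰𝔩₂`-triples, the modules `W(k)`, magical triples -/

/-- A complex simple Lie algebra `𝔤 ⊆ 𝔤𝔩_N(ℂ)` stable under the adjoint, so that
`ρ(X) = -X*` is a compact real form of `𝔤`, together with an `𝔰𝔩₂`-triple `{f, h, e}`. -/
structure Sl2Datum (N : ℕ) where
  𝔤 : LieSubalgebra ℂ (Op N)
  simple : LieAlgebra.IsSimple ℂ 𝔤
  star_mem : ∀ X ∈ 𝔤, star X ∈ 𝔤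
  h : Op N
  e : Op N
  f : Op N
  h_mem : h ∈ 𝔤
  e_mem : e ∈ 𝔤
  f_mem : f ∈ 𝔤
  triple : IsSl2Triple h e f

namespace Sl2Datum

variable (D : Sl2Datum N)

/-- The compact real form `ρ(X) = -X*` of `𝔤`. -/
def rho (X : D.𝔤) : D.𝔤 := ⟨-star (X : Op N), D.𝔤.neg_mem (D.star_mem _ X.2)⟩

/-- The centralizer of `x` in `𝔤`. -/
def centralizer (x : Op N) : Submodule ℂ (Op N) :=
  D.𝔤.toSubmodule ⊓ LinearMap.ker (LieAlgebra.ad ℂ (Op N) x)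

/-- `𝔤_k`, the `k`-eigenspace of `ad_h` in `𝔤`. -/
def grade (k : ℤ) : Submodule ℂ (Op N) :=
  D.𝔤.toSubmodule ⊓ Module.End.eigenspace (LieAlgebra.ad ℂ (Op N) D.h) (k : ℂ)

/-- `V_k = W(k)_k`, the highest weight vectors of weight `k`. -/
def highest (k : ℕ) : Submodule ℂ (Op N) := D.centralizer D.e ⊓ D.grade k

/-- The weight space `W(k)_{k-2i} = ad_f^i(V_k)` of the sum `W(k)` of all the irreducible
`𝔰`-submodules of `𝔤` of highest weight `k`, for `0 ≤ i ≤ k`. -/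
def isotypic (k i : ℕ) : Submodule ℂ (Op N) :=
  (D.highest k).map (LieAlgebra.ad ℂ (Op N) D.f ^ i)

/-- `𝔠 = W(0)`, the centralizer in `𝔤` of the triple. -/
def 𝔠 : Submodule ℂ (Op N) := D.centralizer D.h ⊓ D.centralizer D.e ⊓ D.centralizer D.f

/-- `Z_{2m} = W(2m)_0`. -/
def Z (m : ℕ) : Submodule ℂ (Op N) := D.isotypic (2 * m) m

/-- The sum of all `Z_{2m}`, `m > 0`; the `-1`-eigenspace of the Cayley involution `θ` of
`𝔤₀ = 𝔠 ⊕ ⨁ Z_{2m}`, whose `+1`-eigenspace is `𝔠`. -/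
def thetaOdd : Submodule ℂ (Op N) := ⨆ m : ℕ, ⨆ _ : 0 < m, D.Z m

/-- `𝔤₀^s = [𝔤₀, 𝔤₀]`, the semisimple part of the reductive Lie algebra `𝔤₀`. -/
def g0s : Submodule ℂ (Op N) :=
  Submodule.span ℂ {X | ∃ Y ∈ D.grade 0, ∃ Y' ∈ D.grade 0, X = ⁅Y, Y'⁆}

/-- `𝔪_𝒞`, the `-1`-eigenspace of `θ` in `𝔤₀^s`. -/
def 𝔪C : Submodule ℂ (Op N) := D.g0s ⊓ D.thetaOdd

/-- The semisimple part `𝔤_𝒞^{ℝ,s}` of the Cayley real form: the elements of `𝔤₀^s` which are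
fixed by `θ ∘ ρ`. On `y + z` with `y ∈ 𝔠` and `z` in the `-1`-eigenspace of `θ`, both of them
`ρ`-stable, this says that `ρ y = y` and `ρ z = -z`. -/
def cayleyRealForm : Set (Op N) :=
  {X | X ∈ D.g0s ∧ ∃ y ∈ D.𝔠, ∃ z ∈ D.thetaOdd, X = y + z ∧ -star y = y ∧ -star z = -z}

/-- `m = m_𝒞`: the module `W(2m)` is the one nontrivial isotypic module that meets
`𝔤_𝒞^{ℝ,s}`, that is, the one that contains `𝔪_𝒞`. (If `𝔪_𝒞 = 0`, as for principal triples,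
there is nothing to be contained, and every `m > 0` may serve.) -/
def IsCayleyExponent (m : ℕ) : Prop := 0 < m ∧ D.𝔪C ≤ D.Z m

end Sl2Datum

/-- A magical `𝔰𝔩₂`-triple in a complex simple Lie algebra, with its canonical real form. -/
structure MagicalDatum (N : ℕ) extends Sl2Datum N where
  /-- The magical involution; being magical means that it is a Lie algebra homomorphism. -/
  σ : 𝔤 →ₗ⁅ℂ⁆ 𝔤
  σ_centralizer : ∀ X : 𝔤, (X : Op N) ∈ toSl2Datum.𝔠 → σ X = X
  σ_isotypic : ∀ k i : ℕ, 0 < k → i ≤ k → ∀ X : 𝔤, (X : Op N) ∈ toSl2Datum.isotypic k i →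
    (σ X : Op N) = (-1 : ℂ) ^ (i + 1) • (X : Op N)
  /-- `σ` commutes with `ρ`, so that `τ = ρσ` is a real form with `τσ = στ = ρ`. -/
  σ_rho : ∀ X : 𝔤, σ (toSl2Datum.rho X) = toSl2Datum.rho (σ X)
  tau_h : toSl2Datum.rho (σ ⟨h, h_mem⟩) = -⟨h, h_mem⟩
  tau_e : toSl2Datum.rho (σ ⟨e, e_mem⟩) = ⟨f, f_mem⟩
  tau_f : toSl2Datum.rho (σ ⟨f, f_mem⟩) = ⟨e, e_mem⟩

namespace MagicalDatum

variable (D : MagicalDatum N)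

/-- The canonical real form `τ = ρσ`. -/
def tau (X : D.𝔤) : D.𝔤 := D.rho (D.σ X)

/-- `𝔤^ℝ`, the fixed points of `τ`. -/
def realForm : Set (Op N) := {X | ∃ hX : X ∈ D.𝔤, D.tau ⟨X, hX⟩ = ⟨X, hX⟩}

/-- `𝔥`, the `+1`-eigenspace of `σ`. -/
def 𝔥 : Submodule ℂ (Op N) :=
  (LinearMap.ker ((D.σ : D.𝔤 →ₗ[ℂ] D.𝔤) - LinearMap.id)).map D.𝔤.toSubmodule.subtype

/-- `𝔪`, the `-1`-eigenspace of `σ`. -/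
def 𝔪 : Submodule ℂ (Op N) :=
  (LinearMap.ker ((D.σ : D.𝔤 →ₗ[ℂ] D.𝔤) + LinearMap.id)).map D.𝔤.toSubmodule.subtype

end MagicalDatum

/-- `K` is the complexification of the group `KR` of unitary operators, and `𝔨` is its (complex)
Lie algebra: `K = KR · exp(i 𝔨^ℝ)`, where `i 𝔨^ℝ` is the set of Hermitian elements of `𝔨`. -/
structure IsComplexification (KR K : Subgroup (Op N)ˣ) (𝔨 : Submodule ℂ (Op N)) : Prop where
  lie : HasLieAlgebra K 𝔨
  polar : ∀ a : (Op N)ˣ, a ∈ K ↔ ∃ u ∈ KR, ∃ Y ∈ 𝔨, star Y = Y ∧ a = u * expU Y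

/-- The Lie groups attached to a magical triple. Here `G` is a complex simple Lie group, `GR` its
canonical real form, `GC` the group `G_𝒞^{ℝ,s}` of the semisimple part of the Cayley real form;
`H` and `C` are the complexifications of the maximal compact subgroups `HR = GR ∩ U(N)` and
`CR = GC ∩ U(N)`. -/
structure CayleyGroups (N : ℕ) extends MagicalDatum N where
  G : Subgroup (Op N)ˣ
  G_closed : IsClosed (G : Set (Op N)ˣ)
  G_lie : HasLieAlgebra G 𝔤
  GR : Subgroup (Op N)ˣ
  GR_le : GR ≤ G
  GR_closed : IsClosed (GR : Set (Op N)ˣ)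
  GR_lie : HasLieAlgebra GR toMagicalDatum.realForm
  /-- Cartan decomposition of `GR`: its maximal compact subgroup is `GR ∩ U(N)`. -/
  GR_cartan : ∀ a ∈ GR, ∃ u ∈ GR ⊓ unitaryGroup N, ∃ Y ∈ toMagicalDatum.𝔪,
    star Y = Y ∧ a = u * expU Y
  H : Subgroup (Op N)ˣ
  H_le : H ≤ G
  H_complexification : IsComplexification (GR ⊓ unitaryGroup N) H toMagicalDatum.𝔥
  GC : Subgroup (Op N)ˣ
  GC_le : GC ≤ G
  GC_closed : IsClosed (GC : Set (Op N)ˣ)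
  GC_lie : HasLieAlgebra GC toSl2Datum.cayleyRealForm
  /-- Cartan decomposition of `GC`: its maximal compact subgroup is `GC ∩ U(N)`. -/
  GC_cartan : ∀ a ∈ GC, ∃ u ∈ GC ⊓ unitaryGroup N, ∃ Y ∈ toSl2Datum.𝔪C,
    star Y = Y ∧ a = u * expU Y
  C : Subgroup (Op N)ˣ
  C_le : C ≤ H
  C_complexification : IsComplexification (GC ⊓ unitaryGroup N) C toSl2Datum.𝔠
  /-- `C` commutes with the image of `SL₂(ℂ)` given by the triple. -/
  C_commutes : ∀ a ∈ C, Ad a h = h ∧ Ad a e = e ∧ Ad a f = f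

/-- The maximal compact subgroup `H^ℝ` of `G^ℝ`. -/
def CayleyGroups.HR (D : CayleyGroups N) : Subgroup (Op N)ˣ := D.GR ⊓ unitaryGroup N

/-! ### Bundles on a Riemann surface, by holomorphic cocycles -/

/-- A cover of the Riemann surface `X` by the domains of holomorphic coordinates `z i`. -/
structure CoordCover (X : Type*) [TopologicalSpace X] [ChartedSpace ℂ X] where
  ι : Type*
  z : ι → OpenPartialHomeomorph X ℂ
  mem_atlas : ∀ i, z i ∈ IsManifold.maximalAtlas 𝓘(ℂ) ω X
  exists_mem : ∀ x, ∃ i, x ∈ (z i).source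

variable {X : Type*} [TopologicalSpace X] [ChartedSpace ℂ X]

namespace CoordCover

variable (𝔘 : CoordCover X)

/-- The open set on which the coordinate `z i` is defined. -/
def U (i : 𝔘.ι) : Set X := (𝔘.z i).source

/-- `dz_j / dz_i`; the transition functions of the canonical bundle `K` in the frames `dz_i`. -/
def jac (i j : 𝔘.ι) (x : X) : ℂ := deriv (𝔘.z j ∘ (𝔘.z i).symm) (𝔘.z i x)

/-- `F` is holomorphic on the open set `S ⊆ U i`, read in the coordinate `z i`. -/
def HolOn {A : Type*} [NormedAddCommGroup A] [NormedSpace ℂ A] (i : 𝔘.ι) (S : Set X)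
    (F : X → A) : Prop :=
  DifferentiableOn ℂ (F ∘ (𝔘.z i).symm) ((𝔘.z i).target ∩ (𝔘.z i).symm ⁻¹' S)

end CoordCover

/-- A holomorphic principal `K`-bundle, trivialized over the sets `U i`: its transition functions
`g i j`, which are holomorphic with values in `K`. The point `p_j · a` of the bundle is
`p_i · (g i j x * a)`, where `p_i`, `p_j` are the local frames. -/
structure PrincipalBundle {A : Type*} [NormedRing A] [NormedAlgebra ℂ A] (𝔘 : CoordCover X)
    (K : Subgroup Aˣ) where
  g : 𝔘.ι → 𝔘.ι → X → Aˣ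
  mem : ∀ i j x, x ∈ 𝔘.U i → x ∈ 𝔘.U j → g i j x ∈ K
  hol : ∀ i j, 𝔘.HolOn i (𝔘.U i ∩ 𝔘.U j) (fun x => (g i j x : A))
  cocycle : ∀ i j k x, x ∈ 𝔘.U i → x ∈ 𝔘.U j → x ∈ 𝔘.U k → g i j x * g j k x = g i k x

/-- The frame bundle of a theta characteristic `K^{1/2}`. -/
structure ThetaChar (𝔘 : CoordCover X) extends PrincipalBundle 𝔘 (⊤ : Subgroup ℂˣ) where
  sq : ∀ i j x, x ∈ 𝔘.U i → x ∈ 𝔘.U j → ((g i j x : ℂˣ) : ℂ) ^ 2 = 𝔘.jac i j x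

/-- A holomorphic section of `P(W) ⊗ K^n`, where `W ⊆ 𝔤` is stable under the adjoint action:
over `U i` it is `val i` times `dz_i^n`, in the local frame. -/
structure HolSection {𝔘 : CoordCover X} {K : Subgroup (Op N)ˣ} (P : PrincipalBundle 𝔘 K) (n : ℕ)
    (W : Submodule ℂ (Op N)) where
  val : 𝔘.ι → X → Op N
  mem : ∀ i x, x ∈ 𝔘.U i → val i x ∈ W
  hol : ∀ i, 𝔘.HolOn i (𝔘.U i) (val i)
  trans : ∀ i j x, x ∈ 𝔘.U i → x ∈ 𝔘.U j →
    val i x = 𝔘.jac i j x ^ n • Ad (P.g i j x) (val j x)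

/-- The cocharacter `ℂˣ → G` with differential `h`: the restriction to the diagonal torus of the
homomorphism `SL₂(ℂ) → G` given by the triple. The branch of the logarithm does not matter, as
`exp(2πi h) = 1`. -/
def Sl2Datum.cochar (D : Sl2Datum N) (t : ℂˣ) : (Op N)ˣ := expU (Complex.log (t : ℂ) • D.h)

/-! ### Cayley uniformizing Higgs bundles -/

/-- A Cayley uniformizing `G^ℝ`-Higgs bundle `(P_H, Φ₀)`: the image under the Cayley map of a
`ℂˣ`-fixed `K^{m_𝒞+1}`-twisted `G_𝒞^{ℝ,s}`-Higgs bundle `(P_C, f_𝒞)`. That the latter is a fixed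
point is exhibited by the infinitesimal gauge transformation `h_𝒞`. -/
structure CayleyUniformizing (D : CayleyGroups N) (𝔘 : CoordCover X) where
  /-- `m_𝒞` -/
  m : ℕ
  m_spec : D.IsCayleyExponent m
  PC : PrincipalBundle 𝔘 D.C
  /-- `f_𝒞 dz^{m+1}`, the Higgs field on `P_C` -/
  fC : HolSection PC (m + 1) D.𝔪C
  hC : HolSection PC 0 D.𝔠
  hC_semisimple : ∀ i x, x ∈ 𝔘.U i → Module.End.IsSemisimple
    (LieAlgebra.ad ℂ (Op N) (hC.val i x))
  lie_hC_fC : ∀ i x, x ∈ 𝔘.U i → ⁅hC.val i x, fC.val i x⁆ = (-2 : ℂ) • fC.val i x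
  /-- `K^{1/2}` -/
  theta : ThetaChar 𝔘
  /-- `P_H = P_C ⋆ P_{K^{1/2}}(H)` -/
  PH : PrincipalBundle 𝔘 D.H
  PH_eq : ∀ i j x, x ∈ 𝔘.U i → x ∈ 𝔘.U j →
    PH.g i j x = PC.g i j x * D.cochar (theta.g i j x)
  /-- `f̃_𝒞`, determined by `f̃_𝒞 ∈ V_{2m}` and `ad_f^m(f̃_𝒞) = f_𝒞` -/
  ftilde : HolSection PH 1 (D.highest (2 * m))
  ftilde_eq : ∀ i x, x ∈ 𝔘.U i →
    (LieAlgebra.ad ℂ (Op N) D.f ^ m) (ftilde.val i x) = fC.val i x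
  /-- The Higgs field `Φ₀ = (f + f̃_𝒞) dz` -/
  Φ : HolSection PH 1 D.𝔪
  Φ_eq : ∀ i x, x ∈ 𝔘.U i → Φ.val i x = D.f + ftilde.val i x

/-- The grading element `h₀ = h + (m_𝒞 + 1) h_𝒞`, in the local frames. -/
def CayleyUniformizing.h₀ {D : CayleyGroups N} {𝔘 : CoordCover X} (B : CayleyUniformizing D 𝔘)
    (i : 𝔘.ι) (x : X) : Op N :=
  D.h + ((B.m : ℂ) + 1) • B.hC.val i x

/-! ### Reductions of structure group and Hitchin's equations -/

/-- A smooth reduction of structure group of the `K`-bundle `P` to `KR`: a subset `Q ⊆ P` which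
meets every fibre in one `KR`-orbit and has smooth local sections. Here `fib i x` is the fibre
`Q_x`, as a subset of `K ≅ P_x`, the isomorphism being given by the local frame over `U i`
(it is empty outside `U i`, where there is no such frame). -/
@[ext]
structure Reduction {𝔘 : CoordCover X} {K : Subgroup (Op N)ˣ} (P : PrincipalBundle 𝔘 K)
    (KR : Subgroup (Op N)ˣ) where
  fib : 𝔘.ι → X → Set (Op N)ˣ
  orbit : ∀ i x, x ∈ 𝔘.U i → ∃ a ∈ K, fib i x = {b | ∃ u ∈ KR, b = a * u}
  trans : ∀ i j x, x ∈ 𝔘.U i → x ∈ 𝔘.U j →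
    fib i x = {b | ∃ a ∈ fib j x, b = P.g i j x * a}
  smooth : ∀ i x, x ∈ 𝔘.U i → ∃ a : X → (Op N)ˣ, (∀ᶠ y in 𝓝 x, a y ∈ fib i y) ∧
    ContDiffAt ℝ ∞ (fun w => (a ((𝔘.z i).symm w) : Op N)) (𝔘.z i x)
  fib_empty : ∀ i x, x ∉ 𝔘.U i → fib i x = ∅

/-- The antilinear map `ρ_a = Ad(a) ∘ ρ ∘ Ad(a)⁻¹`, where `ρ(X) = -X*`. -/
def rhoAt (a : (Op N)ˣ) (X : Op N) : Op N := Ad a (-star (Ad a⁻¹ X))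

/-- `ρ_a` depends on `a` only up to unitary operators. -/
theorem rhoAt_mul_unitary (a u : (Op N)ˣ) (hu : u ∈ unitaryGroup N) (X : Op N) :
    rhoAt (a * u) X = rhoAt a X := by
  obtain ⟨v, rfl⟩ := hu
  have h1 : (((Unitary.toUnits v)⁻¹ : (Op N)ˣ) : Op N) = star (v : Op N) := rfl
  have h2 : ((Unitary.toUnits v : (Op N)ˣ) : Op N) = (v : Op N) := rfl
  have h3 : (v : Op N) * star (v : Op N) = 1 := Unitary.coe_mul_star_self v
  have h4 : ∀ Y : Op N, (v : Op N) * (star (v : Op N) * Y) = Y := fun Y => by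
    rw [← mul_assoc, h3, one_mul]
  simp only [rhoAt, Ad, mul_inv_rev, Units.val_mul, h1, h2, inv_inv, star_mul, star_star,
    mul_neg, neg_mul, mul_assoc, h4]

/-- The operator `∂/∂z̄` on functions of a complex variable. -/
def dbar {A : Type*} [NormedAddCommGroup A] [NormedSpace ℂ A] (s : ℂ → A) (w : ℂ) : A :=
  (1 / 2 : ℂ) • (fderiv ℝ s w 1 + Complex.I • fderiv ℝ s w Complex.I)

namespace Reduction

variable {𝔘 : CoordCover X} {K KR : Subgroup (Op N)ˣ} {P : PrincipalBundle 𝔘 K}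
  (Q : Reduction P KR)

open Classical in
/-- The involution `ρ_Q` of `ad P` induced by the reduction, in the frame over `U i`: it is `ρ`
in every frame that belongs to `Q`. -/
def inv (i : 𝔘.ι) (x : X) (Y : Op N) : Op N :=
  if hx : (Q.fib i x).Nonempty then rhoAt hx.some Y else 0

/-- For a group `KR` of unitary operators, `ρ_Q` can be computed in any frame of `Q`. -/
theorem inv_eq (hKR : KR ≤ unitaryGroup N) {i : 𝔘.ι} {x : X} {a : (Op N)ˣ}
    (ha : a ∈ Q.fib i x) (Y : Op N) : Q.inv i x Y = rhoAt a Y := by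
  have hx : x ∈ 𝔘.U i := by
    by_contra hx
    rw [Q.fib_empty i x hx] at ha
    exact ha
  have hne : (Q.fib i x).Nonempty := ⟨a, ha⟩
  have hs := hne.some_mem
  obtain ⟨b, -, hb⟩ := Q.orbit i x hx
  have key : ∀ c ∈ Q.fib i x, rhoAt c Y = rhoAt b Y := by
    intro c hc
    rw [hb] at hc
    obtain ⟨u, hu, rfl⟩ := hc
    exact rhoAt_mul_unitary b u (hKR hu) Y
  rw [inv, dif_pos hne, key _ hs, key _ ha]

/-- The `dz̄`-component `∂̄_P` of the Chern connection `D_Q` on sections `s` of `ad P` over `U i`,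
which are read in the frame over `U i` as functions of the coordinate `w = z_i`. -/
def D'' (_Q : Reduction P KR) (_i : 𝔘.ι) (s : ℂ → Op N) : ℂ → Op N := dbar s

/-- The `dz`-component of the Chern connection `D_Q`, which is `ρ_Q ∘ ∂̄_P ∘ ρ_Q`. -/
def D' (i : 𝔘.ι) (s : ℂ → Op N) (w : ℂ) : Op N :=
  Q.inv i ((𝔘.z i).symm w) (dbar (fun v => Q.inv i ((𝔘.z i).symm v) (s v)) w)

/-- The coefficient of `dz ∧ dz̄` in `F_{D_Q} s = D_Q (D_Q s)`. -/
def curvature (i : 𝔘.ι) (s : ℂ → Op N) (w : ℂ) : Op N :=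
  Q.D' i (Q.D'' i s) w - Q.D'' i (Q.D' i s) w

/-- `Q` is a harmonic reduction with parameter `R` for the Higgs field `Φ = φ dz`: Hitchin's
equation `F_{D_Q} - R² [Φ, ρ_Q(Φ)] = 0`, where `[Φ, ρ_Q(Φ)] = [φ, ρ_Q(φ)] dz ∧ dz̄`. A two-form
with values in `ad P` is determined by its adjoint action on the local smooth sections `s` of
`P(𝔤)`, since `𝔤` has trivial centre, and the equation is tested on these. (The
other equation, `∂̄ Φ = 0`, is part of `Φ` being a holomorphic section.) -/
def IsHarmonic {W : Submodule ℂ (Op N)} (𝔤 : LieSubalgebra ℂ (Op N)) (Φ : HolSection P 1 W)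
    (R : ℝ) : Prop :=
  ∀ (i : 𝔘.ι) (s : ℂ → Op N), ContDiffOn ℝ ∞ s (𝔘.z i).target →
    (∀ w ∈ (𝔘.z i).target, s w ∈ 𝔤) → ∀ x ∈ 𝔘.U i,
      Q.curvature i s (𝔘.z i x) -
        ((R : ℂ) ^ 2) • ⁅⁅Φ.val i x, Q.inv i x (Φ.val i x)⁆, s (𝔘.z i x)⁆ = 0

/-- The section `ξ` of `ad P` takes values in `i · ad Q`, on which `ρ_Q = -1`. -/
def IsImaginary (ξ : 𝔘.ι → X → Op N) : Prop :=
  ∀ i x, x ∈ 𝔘.U i → Q.inv i x (ξ i x) = -ξ i x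

/-- The involution of `Q'` is `R^{-ξ} ∘ ρ_Q`, where `R^{-ξ} = Ad(exp(-log(R) ξ))`. -/
def IsRescaling (Q' : Reduction P KR) (𝔤 : LieSubalgebra ℂ (Op N)) (ξ : 𝔘.ι → X → Op N)
    (R : ℝ) : Prop :=
  ∀ i x, x ∈ 𝔘.U i → ∀ Y ∈ 𝔤,
    Q'.inv i x Y = Ad (expU ((-Real.log R : ℂ) • ξ i x)) (Q.inv i x Y)

end Reduction

end CayleyHiggs

end

open CayleyHiggs

/-!
The grading element `h₀` is a holomorphic section of `P_H(𝔥)`, and the Higgs field `Φ₀` has weight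
`-2` for it (`CayleyUniformizing.lie_h₀_Φ`). Hence `exp(c h₀)`, `c ∈ ℂ`, is a holomorphic gauge
transformation of `P_H` (`CayleyUniformizing.gradingGauge`) that multiplies `Φ₀` by `e^{-2c}`.
The Chern connection is natural under holomorphic gauge transformations, so `exp(c h₀)` carries
harmonic reductions with parameter `R |e^{2c}|` to harmonic reductions with parameter `R`
(`CayleyUniformizing.isHarmonic_gradingGauge_act`), whether or not `h₀` is imaginary. Both parts
of the theorem rest on this action of `ℂ`.

With `c = -½ log R` it carries the harmonic reductions with parameter `1` bijectively to those with
parameter `R`. If `h₀` is imaginary for `Q₀`, then `ρ_{Q₀}` intertwines `exp(c h₀)` and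
`exp(-c h₀)`, and the involution of the image `Q₀(R)` is `R^{-h₀} ∘ ρ_{Q₀}`
(`CayleyUniformizing.isRescaling_gradingGauge_act`). No other reduction has this involution: two
frames with the same involution on `𝔤` differ by some `u exp(Y)` with `u ∈ H^ℝ` and `Y ∈ 𝔥`
Hermitian, for which `exp(2Y)` centralizes `𝔤`; then `Y` is central in the simple Lie algebra `𝔤`
and vanishes (`CayleyGroups.mem_HR_of_rhoAt_eq`).

With `c = it`, `t ∈ ℝ`, the parameter does not change. If `Q₀` is the only harmonic reduction with
parameter `1`, it is therefore invariant under all `exp(ith₀)`, which are then unitary in the frames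
of `Q₀`, and this makes `h₀` imaginary (`CayleyUniformizing.isImaginary_of_unique`).
-/

noncomputable section

namespace CayleyHiggs

/-! ### The adjoint action and one-parameter groups -/

section Adjoint

variable {N : ℕ}

lemma Ad_mul (a b : (Op N)ˣ) (X : Op N) : Ad (a * b) X = Ad a (Ad b X) := by
  simp [Ad, mul_assoc]

@[simp] lemma Ad_one (X : Op N) : Ad 1 X = X := by simp [Ad]

@[simp] lemma Ad_inv_Ad (a : (Op N)ˣ) (X : Op N) : Ad a⁻¹ (Ad a X) = X := by
  rw [← Ad_mul, inv_mul_cancel, Ad_one]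

@[simp] lemma Ad_Ad_inv (a : (Op N)ˣ) (X : Op N) : Ad a (Ad a⁻¹ X) = X := by
  rw [← Ad_mul, mul_inv_cancel, Ad_one]

@[simp] lemma Ad_zero (a : (Op N)ˣ) : Ad a 0 = 0 := by simp [Ad]

lemma Ad_add (a : (Op N)ˣ) (X Y : Op N) : Ad a (X + Y) = Ad a X + Ad a Y := by
  simp [Ad, mul_add, add_mul]

lemma Ad_neg (a : (Op N)ˣ) (X : Op N) : Ad a (-X) = -Ad a X := by simp [Ad]

lemma Ad_sub (a : (Op N)ˣ) (X Y : Op N) : Ad a (X - Y) = Ad a X - Ad a Y := by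
  rw [sub_eq_add_neg, Ad_add, Ad_neg, ← sub_eq_add_neg]

lemma Ad_smul (a : (Op N)ˣ) (c : ℂ) (X : Op N) : Ad a (c • X) = c • Ad a X := by
  simp [Ad]

lemma Ad_lie (a : (Op N)ˣ) (X Y : Op N) : Ad a ⁅X, Y⁆ = ⁅Ad a X, Ad a Y⁆ := by
  simp only [Ring.lie_def, Ad_sub]
  simp [Ad, mul_assoc]

lemma expU_neg (X : Op N) : expU (-X) = (expU X)⁻¹ := by
  ext1
  rfl

lemma expU_add_smul (s t : ℂ) (X : Op N) :
    expU ((s + t) • X) = expU (s • X) * expU (t • X) := by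
  let _ : NormedAlgebra ℚ (Op N) := NormedAlgebra.restrictScalars ℚ ℂ (Op N)
  ext1
  change NormedSpace.exp _ = NormedSpace.exp _ * NormedSpace.exp _
  rw [add_smul, NormedSpace.exp_add_of_commute]
  exact ((Commute.refl X).smul_left s).smul_right t

lemma expU_Ad (a : (Op N)ˣ) (X : Op N) : expU (Ad a X) = a * expU X * a⁻¹ := by
  let _ : NormedAlgebra ℚ (Op N) := NormedAlgebra.restrictScalars ℚ ℂ (Op N)
  ext1
  exact NormedSpace.exp_units_conj a X

/-- `Ad(exp(cξ))` acts on an eigenvector of `ad_ξ` by the exponential of the eigenvalue. -/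
lemma Ad_expU_smul {ξ Y : Op N} {μ : ℂ} (hY : ⁅ξ, Y⁆ = μ • Y) (c : ℂ) :
    Ad (expU (c • ξ)) Y = Complex.exp (c * μ) • Y := by
  let _ : NormedAlgebra ℚ (Op N) := NormedAlgebra.restrictScalars ℚ ℂ (Op N)
  -- `(cξ) Y = Y (cξ + cμ)`, and this intertwining relation passes to the exponentials.
  have hs : SemiconjBy Y (c • ξ + algebraMap ℂ (Op N) (c * μ)) (c • ξ) := by
    have hξ : ξ * Y = Y * ξ + μ • Y := by
      rw [← hY, Ring.lie_def]
      abel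
    simp only [SemiconjBy, mul_add, ← Algebra.commutes, ← Algebra.smul_def, mul_smul_comm,
      smul_mul_assoc, hξ, smul_add, smul_smul]
  have hexp : Y * NormedSpace.exp (c • ξ + algebraMap ℂ (Op N) (c * μ)) =
      NormedSpace.exp (c • ξ) * Y := by
    have h1 := (NormedSpace.exp_series_hasSum_exp' (𝕂 := ℂ)
      (c • ξ + algebraMap ℂ (Op N) (c * μ))).mul_left Y
    have h2 := (NormedSpace.exp_series_hasSum_exp' (𝕂 := ℂ) (c • ξ)).mul_right Y
    refine h1.unique (h2.congr_fun ?_)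
    intro n
    rw [mul_smul_comm, smul_mul_assoc, (hs.pow_right n).eq]
  rw [NormedSpace.exp_add_of_commute (Algebra.commutes _ _).symm,
    ← NormedSpace.algebraMap_exp_comm, ← mul_assoc] at hexp
  have hval : Ad (expU (c • ξ)) Y =
      NormedSpace.exp (c • ξ) * Y * NormedSpace.exp (-(c • ξ)) := rfl
  have hinv : NormedSpace.exp (c • ξ) * NormedSpace.exp (-(c • ξ)) = 1 :=
    (expU (c • ξ)).mul_inv
  rw [hval, ← hexp, ← Algebra.commutes, mul_assoc, mul_assoc, hinv, mul_one, Complex.exp_eq_exp_ℂ,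
    ← Algebra.smul_def]

lemma Ad_expU_of_lie_eq_zero {ξ Y : Op N} (hY : ⁅ξ, Y⁆ = 0) : Ad (expU ξ) Y = Y := by
  simpa using Ad_expU_smul (ξ := ξ) (Y := Y) (μ := 0) (by simpa using hY) (1 : ℂ)

lemma HasLieAlgebra.Ad_mem {K : Subgroup (Op N)ˣ} {S : Set (Op N)} (h : HasLieAlgebra K S)
    {a : (Op N)ˣ} (ha : a ∈ K) {Y : Op N} (hY : Y ∈ S) : Ad a Y ∈ S := by
  refine (h _).2 fun t => ?_
  rw [← Ad_smul, expU_Ad]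
  exact K.mul_mem (K.mul_mem ha ((h Y).1 hY t)) (K.inv_mem ha)

lemma HasLieAlgebra.expU_mem {K : Subgroup (Op N)ˣ} {S : Set (Op N)} (h : HasLieAlgebra K S)
    {Y : Op N} (hY : Y ∈ S) : expU Y ∈ K := by
  simpa using (h Y).1 hY 1

lemma star_val_eq_inv_of_mem_unitaryGroup {u : (Op N)ˣ} (hu : u ∈ unitaryGroup N) :
    star (u : Op N) = ((u⁻¹ : (Op N)ˣ) : Op N) := by
  obtain ⟨v, rfl⟩ := hu
  rfl

/-- `X` is skew-Hermitian as soon as its one-parameter group `exp(tX)`, `t ∈ ℝ`, is unitary. -/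
lemma star_eq_neg_of_expU_mem_unitaryGroup {Y : Op N}
    (h : ∀ t : ℝ, expU ((t : ℂ) • Y) ∈ unitaryGroup N) : star Y = -Y := by
  have hE : (fun t : ℝ => NormedSpace.exp (t • star Y)) = fun t : ℝ =>
      NormedSpace.exp (t • -Y) := by
    funext t
    have h1 := star_val_eq_inv_of_mem_unitaryGroup (h t)
    rw [← expU_neg] at h1
    change star (NormedSpace.exp _) = NormedSpace.exp _ at h1
    let _ : NormedAlgebra ℚ (Op N) := NormedAlgebra.restrictScalars ℚ ℂ (Op N)
    rw [NormedSpace.star_exp, star_smul] at h1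
    simpa using h1
  have h1 := hasDerivAt_exp_smul_const (𝕂 := ℝ) (star Y) (0 : ℝ)
  have h2 := hasDerivAt_exp_smul_const (𝕂 := ℝ) (-Y) (0 : ℝ)
  rw [hE] at h1
  simpa using h1.unique h2

/-- The logarithm of a positive operator is a function of it. -/
lemma commute_of_commute_exp {Y Z : Op N} (hY : star Y = Y)
    (h : Commute (NormedSpace.exp Y) Z) : Commute Y Z := by
  have h1 : Commute (CFC.log (NormedSpace.exp Y)) Z := h.cfc_real Real.log
  rwa [CFC.log_exp Y hY] at h1

end Adjoint

/-! ### The antilinear involutions -/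

section Involution

variable {N : ℕ}

lemma rhoAt_mul (a b : (Op N)ˣ) (Y : Op N) :
    rhoAt (a * b) Y = Ad a (rhoAt b (Ad a⁻¹ Y)) := by
  simp only [rhoAt, mul_inv_rev, Ad_mul]

lemma rhoAt_smul (a : (Op N)ˣ) (c : ℂ) (Y : Op N) : rhoAt a (c • Y) = star c • rhoAt a Y := by
  simp only [rhoAt, Ad_smul, star_smul, ← smul_neg]

/-- If `ρ_a(ξ) = -ξ`, then `ρ_a` intertwines `Ad(exp(tξ))` and `Ad(exp(-tξ))` for real `t`. -/
lemma rhoAt_Ad_expU_smul {a : (Op N)ˣ} {ξ : Op N} (hξ : rhoAt a ξ = -ξ) (t : ℝ) (Y : Op N) :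
    rhoAt a (Ad (expU ((t : ℂ) • ξ)) Y) = Ad (expU (-(t : ℂ) • ξ)) (rhoAt a Y) := by
  let _ : NormedAlgebra ℚ (Op N) := NormedAlgebra.restrictScalars ℚ ℂ (Op N)
  obtain ⟨k, rfl⟩ : ∃ k, ξ = Ad a k := ⟨Ad a⁻¹ ξ, by simp⟩
  have hk : star k = k := by
    simpa [rhoAt, Ad_neg] using congrArg (Ad a⁻¹) hξ
  have hst : ∀ s : ℝ, star ((expU ((s : ℂ) • k) : (Op N)ˣ) : Op N) = expU ((s : ℂ) • k) := by
    intro s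
    change star (NormedSpace.exp _) = NormedSpace.exp _
    rw [NormedSpace.star_exp, star_smul, hk]
    simp
  have hAd : ∀ Z : Op N, -star (Ad (expU ((t : ℂ) • k)) Z) =
      Ad (expU (-(t : ℂ) • k)) (-star Z) := by
    intro Z
    have h1 := hst t
    have h2 := hst (-t)
    push_cast at h2
    have h3 : expU (-(t : ℂ) • k) = (expU ((t : ℂ) • k))⁻¹ := by rw [neg_smul, expU_neg]
    rw [h3] at h2 ⊢
    simp only [Ad, star_mul, h1, h2, inv_inv, mul_neg, neg_mul, mul_assoc]
  simp only [← Ad_smul, expU_Ad, Ad_mul, rhoAt, Ad_inv_Ad, hAd]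

end Involution

/-! ### Holomorphic gauge transformations -/

section Gauge

variable {N : ℕ}

lemma dbar_congr {s t : ℂ → Op N} {w : ℂ} (h : s =ᶠ[𝓝 w] t) : dbar s w = dbar t w := by
  simp only [dbar, h.fderiv_eq]

/-- `∂̄` commutes with multiplication by invertible holomorphic functions `a`, `b`. No regularity
of `s` is needed: if `s` is not differentiable, neither is `a s b`, and both sides are zero. -/
lemma dbar_mul_mul {a b a' b' s : ℂ → Op N} {w : ℂ} (ha : DifferentiableAt ℂ a w)
    (hb : DifferentiableAt ℂ b w) (ha' : DifferentiableAt ℂ a' w)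
    (hb' : DifferentiableAt ℂ b' w) (haa : ∀ v, a' v * a v = 1) (hbb : ∀ v, b v * b' v = 1) :
    dbar (fun v => a v * s v * b v) w = a w * dbar s w * b w := by
  by_cases hs : DifferentiableAt ℝ s w
  · have key : ∀ {c : ℂ → Op N}, DifferentiableAt ℂ c w →
        fderiv ℝ c w Complex.I = Complex.I • fderiv ℝ c w 1 := by
      intro c hc
      rw [hc.fderiv_restrictScalars ℝ]
      simp only [ContinuousLinearMap.coe_restrictScalars']
      rw [← map_smul, smul_eq_mul, mul_one]
    have ha1 := ha.restrictScalars ℝ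
    have hb1 := hb.restrictScalars ℝ
    have hd : fderiv ℝ (fun v => a v * s v * b v) w = _ :=
      (((ha1.hasFDerivAt.mul' hs.hasFDerivAt).mul' hb1.hasFDerivAt)).fderiv
    simp only [dbar, hd]
    simp only [add_apply, smul_apply, MulOpposite.smul_eq_mul_unop,
      MulOpposite.unop_op, smul_eq_mul, key ha, key hb, smul_add, mul_add, add_mul,
      smul_mul_assoc, mul_smul_comm, smul_smul, Complex.I_mul_I]
    module
  · have hns : ¬ DifferentiableAt ℝ (fun v => a v * s v * b v) w := by
      intro h
      refine hs ((((ha'.restrictScalars ℝ).mul h).mul (hb'.restrictScalars ℝ)).congr_of_eventuallyEq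
        (Filter.Eventually.of_forall fun v => ?_))
      simp only [Pi.mul_apply]
      rw [mul_assoc (a v), ← mul_assoc (a' v), haa, one_mul, mul_assoc, hbb, mul_one]
    simp [dbar, fderiv_zero_of_not_differentiableAt hs, fderiv_zero_of_not_differentiableAt hns]

variable {X : Type*} [TopologicalSpace X] [ChartedSpace ℂ X] {𝔘 : CoordCover X}

lemma CoordCover.HolOn.differentiableOn {A : Type*} [NormedAddCommGroup A] [NormedSpace ℂ A]
    {i : 𝔘.ι} {F : X → A} (h : 𝔘.HolOn i (𝔘.U i) F) :
    DifferentiableOn ℂ (F ∘ (𝔘.z i).symm) (𝔘.z i).target :=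
  h.mono fun _ hw => ⟨hw, (𝔘.z i).map_target hw⟩

lemma CoordCover.HolOn.differentiableAt {A : Type*} [NormedAddCommGroup A] [NormedSpace ℂ A]
    {i : 𝔘.ι} {F : X → A} (h : 𝔘.HolOn i (𝔘.U i) F) {w : ℂ} (hw : w ∈ (𝔘.z i).target) :
    DifferentiableAt ℂ (fun v => F ((𝔘.z i).symm v)) w :=
  h.differentiableOn.differentiableAt ((𝔘.z i).open_target.mem_nhds hw)

lemma CoordCover.HolOn.contDiffOn {i : 𝔘.ι} {F : X → Op N} (h : 𝔘.HolOn i (𝔘.U i) F) :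
    ContDiffOn ℝ ∞ (fun v => F ((𝔘.z i).symm v)) (𝔘.z i).target :=
  (h.differentiableOn.contDiffOn (𝔘.z i).open_target).restrict_scalars ℝ

variable {K KR : Subgroup (Op N)ˣ}

/-- A holomorphic gauge transformation of the principal bundle `P`, that is, a holomorphic section
of the bundle of groups `P ×_Ad K`; over `U i` it is given in the local frame. -/
structure HolGauge (P : PrincipalBundle 𝔘 K) where
  /-- The gauge transformation in the local frame over `U i`. -/
  val : 𝔘.ι → X → (Op N)ˣ
  mem : ∀ i x, x ∈ 𝔘.U i → val i x ∈ K
  hol : ∀ i, 𝔘.HolOn i (𝔘.U i) (fun x => (val i x : Op N))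
  hol_inv : ∀ i, 𝔘.HolOn i (𝔘.U i) (fun x => ((val i x)⁻¹ : (Op N)ˣ).val)
  trans : ∀ i j x, x ∈ 𝔘.U i → x ∈ 𝔘.U j → val i x * P.g i j x = P.g i j x * val j x

variable {P : PrincipalBundle 𝔘 K}

/-- The image of a reduction of structure group under a holomorphic gauge transformation. -/
def HolGauge.act (γ : HolGauge P) (Q : Reduction P KR) : Reduction P KR where
  fib i x := {b | ∃ a ∈ Q.fib i x, b = γ.val i x * a}
  orbit i x hx := by
    obtain ⟨a, ha, hQ⟩ := Q.orbit i x hx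
    refine ⟨γ.val i x * a, K.mul_mem (γ.mem i x hx) ha, ?_⟩
    ext b
    simp only [hQ, Set.mem_ofPred_eq]
    constructor
    · rintro ⟨_, ⟨u, hu, rfl⟩, rfl⟩
      exact ⟨u, hu, by rw [mul_assoc]⟩
    · rintro ⟨u, hu, rfl⟩
      exact ⟨_, ⟨u, hu, rfl⟩, by rw [mul_assoc]⟩
  trans i j x hi hj := by
    rw [Q.trans i j x hi hj]
    ext b
    constructor
    · rintro ⟨_, ⟨a, ha, rfl⟩, rfl⟩
      exact ⟨_, ⟨a, ha, rfl⟩, by rw [← mul_assoc, γ.trans i j x hi hj, mul_assoc]⟩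
    · rintro ⟨_, ⟨a, ha, rfl⟩, rfl⟩
      exact ⟨_, ⟨a, ha, rfl⟩, by rw [← mul_assoc, ← γ.trans i j x hi hj, mul_assoc]⟩
  smooth i x hx := by
    obtain ⟨a, ha, hs⟩ := Q.smooth i x hx
    refine ⟨fun y => γ.val i y * a y, ha.mono fun y hy => ⟨_, hy, rfl⟩, ?_⟩
    have hγ := (γ.hol i).contDiffOn.contDiffAt
      ((𝔘.z i).open_target.mem_nhds ((𝔘.z i).map_source hx))
    exact hγ.mul hs
  fib_empty i x hx := by
    rw [Q.fib_empty i x hx]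
    ext b
    simp

lemma HolGauge.act_act (γ δ ε : HolGauge P) (h : ∀ i x, δ.val i x * γ.val i x = ε.val i x)
    (Q : Reduction P KR) : δ.act (γ.act Q) = ε.act Q := by
  ext i x b
  constructor
  · rintro ⟨_, ⟨a, ha, rfl⟩, rfl⟩
    exact ⟨a, ha, by rw [← h, mul_assoc]⟩
  · rintro ⟨a, ha, rfl⟩
    exact ⟨_, ⟨a, ha, rfl⟩, by rw [← h, mul_assoc]⟩

lemma HolGauge.act_of_val_eq_one (γ : HolGauge P) (h : ∀ i x, γ.val i x = 1)
    (Q : Reduction P KR) : γ.act Q = Q := by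
  ext i x b
  simp [HolGauge.act, h]

lemma Reduction.fib_nonempty (Q : Reduction P KR) {i : 𝔘.ι} {x : X} (hx : x ∈ 𝔘.U i) :
    (Q.fib i x).Nonempty := by
  obtain ⟨a, -, hQ⟩ := Q.orbit i x hx
  exact ⟨a, by rw [hQ]; exact ⟨1, KR.one_mem, by simp⟩⟩

lemma HolGauge.inv_act (hKR : KR ≤ unitaryGroup N) (γ : HolGauge P) (Q : Reduction P KR)
    (i : 𝔘.ι) (x : X) (Y : Op N) :
    (γ.act Q).inv i x Y = Ad (γ.val i x) (Q.inv i x (Ad (γ.val i x)⁻¹ Y)) := by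
  by_cases hx : x ∈ 𝔘.U i
  · obtain ⟨a, ha⟩ := Q.fib_nonempty hx
    rw [Q.inv_eq hKR ha, (γ.act Q).inv_eq hKR (a := γ.val i x * a) ⟨a, ha, rfl⟩, rhoAt_mul]
  · simp [Reduction.inv, Q.fib_empty i x hx, (γ.act Q).fib_empty i x hx]

lemma HolGauge.dbar_Ad (γ : HolGauge P) (i : 𝔘.ι) (s : ℂ → Op N) {w : ℂ}
    (hw : w ∈ (𝔘.z i).target) :
    dbar (fun v => Ad (γ.val i ((𝔘.z i).symm v)) (s v)) w =
      Ad (γ.val i ((𝔘.z i).symm w)) (dbar s w) :=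
  dbar_mul_mul ((γ.hol i).differentiableAt hw) ((γ.hol_inv i).differentiableAt hw)
    ((γ.hol_inv i).differentiableAt hw) ((γ.hol i).differentiableAt hw) (by simp) (by simp)

lemma HolGauge.dbar_Ad_inv (γ : HolGauge P) (i : 𝔘.ι) (s : ℂ → Op N) {w : ℂ}
    (hw : w ∈ (𝔘.z i).target) :
    dbar (fun v => Ad (γ.val i ((𝔘.z i).symm v))⁻¹ (s v)) w =
      Ad (γ.val i ((𝔘.z i).symm w))⁻¹ (dbar s w) := by
  refine dbar_mul_mul ((γ.hol_inv i).differentiableAt hw) ?_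
    ((γ.hol i).differentiableAt hw) ((γ.hol_inv i).differentiableAt hw) (by simp) (by simp)
  simpa using (γ.hol i).differentiableAt hw

/-- The `(1,0)`-part of the Chern connection is natural under holomorphic gauge
transformations. -/
lemma HolGauge.D'_act (hKR : KR ≤ unitaryGroup N) (γ : HolGauge P) (Q : Reduction P KR)
    (i : 𝔘.ι) (s : ℂ → Op N) {w : ℂ} (hw : w ∈ (𝔘.z i).target) :
    (γ.act Q).D' i s w = Ad (γ.val i ((𝔘.z i).symm w))
      (Q.D' i (fun v => Ad (γ.val i ((𝔘.z i).symm v))⁻¹ (s v)) w) := by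
  simp only [Reduction.D', γ.inv_act hKR]
  rw [γ.dbar_Ad i _ hw, Ad_inv_Ad]

lemma Reduction.D'_congr (Q : Reduction P KR) (i : 𝔘.ι) {s t : ℂ → Op N} {w : ℂ}
    (h : s =ᶠ[𝓝 w] t) : Q.D' i s w = Q.D' i t w := by
  have h' : (fun v => Q.inv i ((𝔘.z i).symm v) (s v)) =ᶠ[𝓝 w]
      fun v => Q.inv i ((𝔘.z i).symm v) (t v) := h.mono fun v hv => by simp only [hv]
  simp only [Reduction.D', dbar_congr h']

lemma HolGauge.curvature_act (hKR : KR ≤ unitaryGroup N) (γ : HolGauge P) (Q : Reduction P KR)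
    (i : 𝔘.ι) (s : ℂ → Op N) {w : ℂ} (hw : w ∈ (𝔘.z i).target) :
    (γ.act Q).curvature i s w = Ad (γ.val i ((𝔘.z i).symm w))
      (Q.curvature i (fun v => Ad (γ.val i ((𝔘.z i).symm v))⁻¹ (s v)) w) := by
  have hnhds := (𝔘.z i).open_target.mem_nhds hw
  have h1 : (γ.act Q).D' i (dbar s) w = Ad (γ.val i ((𝔘.z i).symm w))
      (Q.D' i (dbar fun v => Ad (γ.val i ((𝔘.z i).symm v))⁻¹ (s v)) w) := by
    rw [γ.D'_act hKR Q i _ hw]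
    rw [Q.D'_congr i]
    filter_upwards [hnhds] with v hv
    rw [γ.dbar_Ad_inv i _ hv]
  have h2 : dbar ((γ.act Q).D' i s) w = Ad (γ.val i ((𝔘.z i).symm w))
      (dbar (Q.D' i fun v => Ad (γ.val i ((𝔘.z i).symm v))⁻¹ (s v)) w) := by
    rw [← γ.dbar_Ad i _ hw]
    refine dbar_congr ?_
    filter_upwards [hnhds] with v hv
    exact γ.D'_act hKR Q i _ hv
  simp only [Reduction.curvature, Reduction.D'', h1, h2, Ad_sub]

lemma Reduction.inv_smul (hKR : KR ≤ unitaryGroup N) (Q : Reduction P KR) {i : 𝔘.ι} {x : X}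
    (hx : x ∈ 𝔘.U i) (c : ℂ) (Y : Op N) : Q.inv i x (c • Y) = star c • Q.inv i x Y := by
  obtain ⟨a, ha⟩ := Q.fib_nonempty hx
  rw [Q.inv_eq hKR ha, Q.inv_eq hKR ha, rhoAt_smul]

/-- A gauge transformation whose inverse multiplies the Higgs field by a scalar `c` carries harmonic
reductions with parameter `R ‖c‖` to harmonic reductions with parameter `R`. -/
lemma HolGauge.isHarmonic_act (hKR : KR ≤ unitaryGroup N) {W : Submodule ℂ (Op N)}
    {𝔤 : LieSubalgebra ℂ (Op N)} (hK : ∀ a ∈ K, ∀ Y ∈ 𝔤, Ad a Y ∈ 𝔤) (Φ : HolSection P 1 W)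
    (γ : HolGauge P) (c : ℂ)
    (hγ : ∀ i x, x ∈ 𝔘.U i → Ad (γ.val i x)⁻¹ (Φ.val i x) = c • Φ.val i x)
    {Q : Reduction P KR} {R R' : ℝ} (hR : R' = R * ‖c‖) (hQ : Q.IsHarmonic 𝔤 Φ R') :
    (γ.act Q).IsHarmonic 𝔤 Φ R := by
  intro i s hs hs𝔤 x hx
  have hw := (𝔘.z i).map_source hx
  have hzx : (𝔘.z i).symm (𝔘.z i x) = x := (𝔘.z i).left_inv hx
  have h := hQ i (fun v => Ad (γ.val i ((𝔘.z i).symm v))⁻¹ (s v))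
    (by
      have h1 := ((γ.hol_inv i).contDiffOn.mul hs).mul (γ.hol i).contDiffOn
      simpa only [Ad, inv_inv] using h1)
    (fun w hw' => hK _ (K.inv_mem (γ.mem i _ ((𝔘.z i).map_target hw'))) _ (hs𝔤 w hw')) x hx
  have h' := congrArg (Ad (γ.val i x)) h
  rw [Ad_zero, Ad_sub, Ad_smul, Ad_lie, hzx, Ad_Ad_inv] at h'
  have hΦ : Φ.val i x = c • Ad (γ.val i x) (Φ.val i x) := by
    rw [← Ad_smul, ← hγ i x hx, Ad_Ad_inv]
  have hcc : c * star c = (‖c‖ : ℂ) ^ 2 := Complex.mul_conj' c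
  have hlie : ⁅Φ.val i x, (γ.act Q).inv i x (Φ.val i x)⁆ =
      ((‖c‖ : ℂ) ^ 2) • Ad (γ.val i x) ⁅Φ.val i x, Q.inv i x (Φ.val i x)⁆ := by
    rw [γ.inv_act hKR, hγ i x hx, Q.inv_smul hKR hx, Ad_smul, Ad_lie, ← hcc, mul_smul,
      ← lie_smul, ← smul_lie, ← hΦ]
  rw [γ.curvature_act hKR Q i s hw, hzx, hlie, smul_lie, smul_smul, ← mul_pow, ← h', hR]
  push_cast
  rfl

end Gauge

/-! ### The grading element -/

section Grading

variable {N : ℕ}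

lemma Sl2Datum.mem_grade_iff (D : Sl2Datum N) {k : ℤ} {Y : Op N} :
    Y ∈ D.grade k ↔ Y ∈ D.𝔤 ∧ ⁅D.h, Y⁆ = (k : ℂ) • Y := by
  simp [Sl2Datum.grade]

lemma Sl2Datum.mem_centralizer_iff (D : Sl2Datum N) {y Y : Op N} :
    Y ∈ D.centralizer y ↔ Y ∈ D.𝔤 ∧ ⁅y, Y⁆ = 0 := by
  simp [Sl2Datum.centralizer]

lemma Sl2Datum.mem_𝔠_iff (D : Sl2Datum N) {Y : Op N} :
    Y ∈ D.𝔠 ↔ Y ∈ D.𝔤 ∧ ⁅D.h, Y⁆ = 0 ∧ ⁅D.e, Y⁆ = 0 ∧ ⁅D.f, Y⁆ = 0 := by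
  simp only [Sl2Datum.𝔠, Submodule.mem_inf, D.mem_centralizer_iff]
  tauto

lemma Sl2Datum.mem_highest_iff (D : Sl2Datum N) {k : ℕ} {Y : Op N} :
    Y ∈ D.highest k ↔ Y ∈ D.𝔤 ∧ ⁅D.e, Y⁆ = 0 ∧ ⁅D.h, Y⁆ = (k : ℂ) • Y := by
  simp only [Sl2Datum.highest, Submodule.mem_inf, D.mem_centralizer_iff, D.mem_grade_iff,
    Int.cast_natCast]
  tauto

/-- `ad_f^i` is injective on the highest weight vectors of weight `k ≥ i`. -/
lemma Sl2Datum.eq_zero_of_ad_f_pow_eq_zero (D : Sl2Datum N) {k i : ℕ} (hi : i ≤ k) {Y : Op N}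
    (hY : Y ∈ D.highest k) (h : (LieAlgebra.ad ℂ (Op N) D.f ^ i) Y = 0) : Y = 0 := by
  by_contra hne
  obtain ⟨-, he, hh⟩ := D.mem_highest_iff.1 hY
  have P : IsSl2Triple.HasPrimitiveVectorWith D.triple Y (k : ℂ) := ⟨hne, hh, he⟩
  exact P.pow_toEnd_f_ne_zero_of_eq_nat rfl hi h

/-- Elements of the centralizer of `f` commute with `ad_f`. -/
lemma lie_ad_pow {c f : Op N} (hc : ⁅f, c⁆ = 0) (i : ℕ) (Y : Op N) :
    ⁅c, (LieAlgebra.ad ℂ (Op N) f ^ i) Y⁆ = (LieAlgebra.ad ℂ (Op N) f ^ i) ⁅c, Y⁆ := by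
  have hc' : ⁅c, f⁆ = 0 := by rw [← lie_skew, hc, neg_zero]
  induction i with
  | zero => simp
  | succ i ih =>
    rw [pow_succ', Module.End.mul_apply, Module.End.mul_apply, LieAlgebra.ad_apply,
      LieAlgebra.ad_apply, leibniz_lie, hc', zero_lie, zero_add, ih]

lemma MagicalDatum.mem_𝔥_iff (D : MagicalDatum N) {Y : Op N} :
    Y ∈ D.𝔥 ↔ ∃ hY : Y ∈ D.𝔤, D.σ ⟨Y, hY⟩ = ⟨Y, hY⟩ := by
  simp [MagicalDatum.𝔥, sub_eq_zero]

lemma MagicalDatum.𝔠_le_𝔥 (D : MagicalDatum N) : D.𝔠 ≤ D.𝔥 := fun Y hY =>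
  D.mem_𝔥_iff.2 ⟨(D.mem_𝔠_iff.1 hY).1, D.σ_centralizer ⟨Y, _⟩ hY⟩

lemma MagicalDatum.h_mem_𝔥 (D : MagicalDatum N) : D.h ∈ D.𝔥 := by
  refine D.mem_𝔥_iff.2 ⟨D.h_mem, Subtype.ext ?_⟩
  -- `h = [e, f]` lies in the middle weight space of `W(2)`.
  have he : D.e ∈ D.highest 2 :=
    D.mem_highest_iff.2 ⟨D.e_mem, lie_self _, by simpa using D.triple.lie_h_e_smul ℂ⟩
  have hh : D.h ∈ D.isotypic 2 1 := by
    refine ⟨-D.e, Submodule.neg_mem _ he, ?_⟩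
    simp [D.triple.lie_e_f, lie_skew]
  simpa using D.σ_isotypic 2 1 (by norm_num) (by norm_num) ⟨D.h, D.h_mem⟩ hh

variable {D : CayleyGroups N}
variable {X : Type*} [TopologicalSpace X] [ChartedSpace ℂ X] {𝔘 : CoordCover X}

namespace CayleyUniformizing

variable (B : CayleyUniformizing D 𝔘)

lemma h₀_mem {i : 𝔘.ι} {x : X} (hx : x ∈ 𝔘.U i) : B.h₀ i x ∈ D.𝔥 :=
  D.𝔥.add_mem D.h_mem_𝔥 (D.𝔥.smul_mem _ (D.𝔠_le_𝔥 (B.hC.mem i x hx)))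

lemma h₀_hol (i : 𝔘.ι) : 𝔘.HolOn i (𝔘.U i) (B.h₀ i) :=
  ((B.hC.hol i).const_smul ((B.m : ℂ) + 1)).const_add D.h

/-- The grading element is a section of the adjoint bundle. -/
lemma h₀_trans {i j : 𝔘.ι} {x : X} (hi : x ∈ 𝔘.U i) (hj : x ∈ 𝔘.U j) :
    Ad (B.PH.g i j x) (B.h₀ j x) = B.h₀ i x := by
  have hc : ⁅D.h, B.hC.val j x⁆ = 0 := (D.mem_𝔠_iff.1 (B.hC.mem j x hj)).2.1
  have hcochar : ∀ t : ℂˣ, Ad (D.cochar t) (B.h₀ j x) = B.h₀ j x := fun t =>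
    Ad_expU_of_lie_eq_zero (by simp [h₀, hc])
  have ht := B.hC.trans i j x hi hj
  rw [pow_zero, one_smul] at ht
  rw [B.PH_eq i j x hi hj, Ad_mul, hcochar, h₀, Ad_add, Ad_smul, ← ht,
    (D.C_commutes _ (B.PC.mem i j x hi hj)).1, h₀]

/-- The Higgs field has weight `-2` for the grading element: `f` has weight `-2` for `h` and `0`
for `h_𝒞`, and `f̃_𝒞` has weights `2m` and `-2`, so that it has weight `2m - 2(m + 1) = -2`. -/
lemma lie_h₀_Φ {i : 𝔘.ι} {x : X} (hx : x ∈ 𝔘.U i) :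
    ⁅B.h₀ i x, B.Φ.val i x⁆ = (-2 : ℂ) • B.Φ.val i x := by
  obtain ⟨hc𝔤, hch, hce, hcf⟩ := D.mem_𝔠_iff.1 (B.hC.mem i x hx)
  set c := B.hC.val i x
  set v := B.ftilde.val i x
  have hv := B.ftilde.mem i x hx
  obtain ⟨hv𝔤, hve, hvh⟩ := D.mem_highest_iff.1 hv
  have hskew : ∀ {y : Op N}, ⁅y, c⁆ = 0 → ⁅c, y⁆ = 0 := fun h => by rw [← lie_skew, h, neg_zero]
  have hcv_mem : ⁅c, v⁆ ∈ D.highest (2 * B.m) := by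
    refine D.mem_highest_iff.2 ⟨D.𝔤.lie_mem hc𝔤 hv𝔤, ?_, ?_⟩
    · rw [leibniz_lie, hce, hve, zero_lie, lie_zero, add_zero]
    · rw [leibniz_lie, hch, hvh, zero_lie, lie_smul, zero_add]
  have hcv : ⁅c, v⁆ = (-2 : ℂ) • v := by
    rw [← sub_eq_zero]
    refine D.eq_zero_of_ad_f_pow_eq_zero (i := B.m) (k := 2 * B.m) (by omega)
      (Submodule.sub_mem _ hcv_mem (Submodule.smul_mem _ _ hv)) ?_
    rw [map_sub, map_smul, ← lie_ad_pow hcf, B.ftilde_eq i x hx, B.lie_hC_fC i x hx, sub_self]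
  have hhf : ⁅D.h, D.f⁆ = (-2 : ℂ) • D.f := by
    rw [D.triple.lie_lie_smul_f ℂ, neg_smul]
  rw [B.Φ_eq i x hx, h₀, add_lie, smul_lie, lie_add, lie_add, hskew hcf, hcv, hhf, hvh]
  push_cast
  module

/-- The holomorphic gauge transformation `exp(c h₀)`. -/
def gradingGauge (c : ℂ) : HolGauge B.PH where
  val i x := expU (c • B.h₀ i x)
  mem i _ hx := D.H_complexification.lie.expU_mem (D.𝔥.smul_mem c (B.h₀_mem hx))
  hol i := fun w hw => (NormedSpace.exp_analytic _).differentiableAt.comp_differentiableWithinAt w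
    ((B.h₀_hol i w hw).const_smul c)
  hol_inv i := fun w hw =>
    (NormedSpace.exp_analytic _).differentiableAt.comp_differentiableWithinAt w
      ((B.h₀_hol i w hw).const_smul c).neg
  trans i j x hi hj := by
    rw [← B.h₀_trans hi hj, ← Ad_smul, expU_Ad, inv_mul_cancel_right]

variable {KR : Subgroup (Op N)ˣ}

lemma gradingGauge_act_act (c d : ℂ) (Q : Reduction B.PH KR) :
    (B.gradingGauge c).act ((B.gradingGauge d).act Q) = (B.gradingGauge (c + d)).act Q :=
  HolGauge.act_act _ _ _ (fun _ _ => (expU_add_smul c d _).symm) Q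

lemma gradingGauge_zero_act (Q : Reduction B.PH KR) : (B.gradingGauge 0).act Q = Q :=
  HolGauge.act_of_val_eq_one _ (fun i x => by ext1; simp [gradingGauge, expU]) Q

end CayleyUniformizing

lemma CayleyGroups.HR_le_unitaryGroup (D : CayleyGroups N) : D.HR ≤ unitaryGroup N := inf_le_right

lemma CayleyGroups.Ad_mem_of_mem_H (D : CayleyGroups N) {a : (Op N)ˣ} (ha : a ∈ D.H) {Y : Op N}
    (hY : Y ∈ D.𝔤) : Ad a Y ∈ D.𝔤 :=
  D.G_lie.Ad_mem (D.H_le ha) hY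

/-- Acting by `exp(c h₀)` divides the parameter of a harmonic reduction by `|e^{2c}|`, because
`Φ₀` has weight `-2`. -/
lemma CayleyUniformizing.isHarmonic_gradingGauge_act (B : CayleyUniformizing D 𝔘) (c : ℂ)
    {Q : Reduction B.PH D.HR} {R R' : ℝ} (hR : R' = R * Real.exp (2 * c.re))
    (hQ : Q.IsHarmonic D.𝔤 B.Φ R') : ((B.gradingGauge c).act Q).IsHarmonic D.𝔤 B.Φ R := by
  refine HolGauge.isHarmonic_act D.HR_le_unitaryGroup (fun a ha Y hY => D.Ad_mem_of_mem_H ha hY)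
    B.Φ _ (Complex.exp (2 * c)) (fun i x hx => ?_) (by simpa [Complex.norm_exp] using hR) hQ
  change Ad (expU (c • B.h₀ i x))⁻¹ _ = _
  rw [← expU_neg, ← neg_smul, Ad_expU_smul (B.lie_h₀_Φ hx)]
  congr 2
  ring

/-! ### Rigidity of reductions with a given involution -/

/-- The centre of the simple Lie algebra `𝔤` is trivial. -/
lemma Sl2Datum.eq_zero_of_forall_commute (D : Sl2Datum N) {Y : Op N} (hY : Y ∈ D.𝔤)
    (h : ∀ Z ∈ D.𝔤, Commute Y Z) : Y = 0 := by
  have := D.simple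
  have hker : (⟨Y, hY⟩ : D.𝔤) ∈ (LieAlgebra.ad ℂ D.𝔤).ker := by
    rw [LieHom.mem_ker]
    ext Z
    simpa [Ring.lie_def, sub_eq_zero] using (h Z Z.2).eq
  rw [LieAlgebra.ad_ker_eq_bot_of_hasTrivialRadical, LieSubmodule.mem_bot] at hker
  exact congrArg Subtype.val hker

/-- An element `u exp(Y)` of `H` whose involution is `ρ` lies in `H^ℝ`: the positive operator
`u exp(2Y) u⁻¹` centralizes `𝔤`, hence so do `exp(2Y)` and `Y`, and therefore `Y = 0`. -/
lemma CayleyGroups.mem_HR_of_rhoAt_eq (D : CayleyGroups N) {d : (Op N)ˣ} (hd : d ∈ D.H)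
    (h : ∀ Y ∈ D.𝔤, rhoAt d Y = rhoAt 1 Y) : d ∈ D.HR := by
  obtain ⟨u, hu, Y, hY, hYs, rfl⟩ := (D.H_complexification.polar d).1 hd
  have hY𝔤 : Y ∈ D.𝔤 := (D.mem_𝔥_iff.1 hY).1
  have huG : u ∈ D.G := D.GR_le hu.1
  have hus := star_val_eq_inv_of_mem_unitaryGroup hu.2
  have hu1 : ∀ Z, rhoAt u Z = rhoAt 1 Z := fun Z => by
    rw [← one_mul u, rhoAt_mul_unitary 1 u hu.2]
  -- `ρ_{exp Y} = ρ` on `𝔤`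
  have hexp : ∀ Z ∈ D.𝔤, rhoAt (expU Y) Z = -star Z := by
    intro Z hZ
    have h1 := h _ (D.G_lie.Ad_mem huG hZ)
    rw [rhoAt_mul, Ad_inv_Ad, ← hu1, ← mul_one u, rhoAt_mul, mul_one, Ad_inv_Ad] at h1
    have h2 := congrArg (Ad u⁻¹) h1
    rw [Ad_inv_Ad, Ad_inv_Ad] at h2
    simpa [rhoAt] using h2
  have hE : star ((expU Y : (Op N)ˣ) : Op N) = expU Y := by
    let _ : NormedAlgebra ℚ (Op N) := NormedAlgebra.restrictScalars ℚ ℂ (Op N)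
    change star (NormedSpace.exp Y) = NormedSpace.exp Y
    rw [NormedSpace.star_exp, hYs]
  have hE' : star (((expU Y)⁻¹ : (Op N)ˣ) : Op N) = ((expU Y)⁻¹ : (Op N)ˣ) := by
    let _ : NormedAlgebra ℚ (Op N) := NormedAlgebra.restrictScalars ℚ ℂ (Op N)
    rw [← expU_neg]
    change star (NormedSpace.exp (-Y)) = NormedSpace.exp (-Y)
    rw [NormedSpace.star_exp, star_neg, hYs]
  have hsq : expU Y * expU Y = expU ((2 : ℂ) • Y) := by
    rw [show (2 : ℂ) = 1 + 1 by norm_num, expU_add_smul, one_smul]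
  have hcomm : ∀ Z ∈ D.𝔤, Commute Y Z := by
    intro Z hZ
    have h1 := hexp _ (D.star_mem Z hZ)
    have h2 : Ad (expU ((2 : ℂ) • Y)) Z = Z := by
      rw [← hsq, Ad_mul]
      simpa [rhoAt, Ad, star_mul, hE, hE', mul_assoc] using h1
    have h3 : Commute (NormedSpace.exp ((2 : ℂ) • Y)) Z := by
      have h4 := congrArg (· * ((expU ((2 : ℂ) • Y) : (Op N)ˣ) : Op N)) h2
      change ((expU ((2 : ℂ) • Y) : (Op N)ˣ) : Op N) * Z = Z * expU ((2 : ℂ) • Y)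
      simpa [Ad] using h4
    have h5 := commute_of_commute_exp (by simp [hYs]) h3
    simpa using h5.smul_left ((2 : ℂ)⁻¹)
  have hY0 : Y = 0 := D.eq_zero_of_forall_commute hY𝔤 hcomm
  have h1 : expU (0 : Op N) = 1 := by ext1; simp [expU]
  rw [hY0, h1, mul_one]
  exact hu

/-- A reduction to `H^ℝ` is determined by its involution on `𝔤`. -/
lemma Reduction.eq_of_inv_eq {P : PrincipalBundle 𝔘 D.H} {Q Q' : Reduction P D.HR}
    (h : ∀ i x, x ∈ 𝔘.U i → ∀ Y ∈ D.𝔤, Q.inv i x Y = Q'.inv i x Y) : Q = Q' := by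
  ext1
  funext i x
  by_cases hx : x ∈ 𝔘.U i
  · obtain ⟨a, ha, hQ⟩ := Q.orbit i x hx
    obtain ⟨b, hb, hQ'⟩ := Q'.orbit i x hx
    have haQ : a ∈ Q.fib i x := by rw [hQ]; exact ⟨1, D.HR.one_mem, by simp⟩
    have hbQ' : b ∈ Q'.fib i x := by rw [hQ']; exact ⟨1, D.HR.one_mem, by simp⟩
    have hmem : b⁻¹ * a ∈ D.HR := by
      refine D.mem_HR_of_rhoAt_eq (D.H.mul_mem (D.H.inv_mem hb) ha) fun Y hY => ?_
      have h1 := h i x hx _ (D.Ad_mem_of_mem_H hb hY)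
      rw [Q.inv_eq D.HR_le_unitaryGroup haQ, Q'.inv_eq D.HR_le_unitaryGroup hbQ'] at h1
      rw [rhoAt_mul, inv_inv, h1, ← mul_one b, rhoAt_mul, mul_one, Ad_inv_Ad, Ad_inv_Ad]
    rw [hQ, hQ']
    ext c
    constructor
    · rintro ⟨u, hu, rfl⟩
      exact ⟨b⁻¹ * a * u, D.HR.mul_mem hmem hu, by group⟩
    · rintro ⟨u, hu, rfl⟩
      exact ⟨(b⁻¹ * a)⁻¹ * u, D.HR.mul_mem (D.HR.inv_mem hmem) hu, by group⟩
  · rw [Q.fib_empty i x hx, Q'.fib_empty i x hx]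

/-! ### The flow of the grading element on harmonic reductions -/

namespace CayleyUniformizing

variable (B : CayleyUniformizing D 𝔘)

/-- If `h₀` is imaginary for `Q`, then the gauge transformation by the square root
`exp(-½ log(R) h₀)` changes `ρ_Q` into `R^{-h₀} ∘ ρ_Q`. -/
lemma isRescaling_gradingGauge_act {Q : Reduction B.PH D.HR} (hQ : Q.IsImaginary B.h₀) (R : ℝ) :
    Q.IsRescaling ((B.gradingGauge ((-Real.log R / 2 : ℝ) : ℂ)).act Q) D.𝔤 B.h₀ R := by
  intro i x hx Y _
  obtain ⟨a, ha⟩ := Q.fib_nonempty hx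
  have h1 := hQ i x hx
  rw [HolGauge.inv_act D.HR_le_unitaryGroup]
  simp only [Q.inv_eq D.HR_le_unitaryGroup ha] at h1 ⊢
  set t : ℝ := -Real.log R / 2
  have hinv : ((B.gradingGauge t).val i x)⁻¹ = expU (((-t : ℝ) : ℂ) • B.h₀ i x) := by
    change (expU _)⁻¹ = _
    rw [← expU_neg, ← neg_smul, Complex.ofReal_neg]
  have hval : (B.gradingGauge t).val i x = expU ((t : ℂ) • B.h₀ i x) := rfl
  rw [hinv, rhoAt_Ad_expU_smul h1, hval, ← Ad_mul, ← expU_add_smul]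
  congr 3
  simp only [t]
  push_cast
  ring

lemma isRescaling_iff {Q : Reduction B.PH D.HR} (hQ : Q.IsImaginary B.h₀) (R : ℝ)
    (Q' : Reduction B.PH D.HR) : Q.IsRescaling Q' D.𝔤 B.h₀ R ↔
      Q' = (B.gradingGauge ((-Real.log R / 2 : ℝ) : ℂ)).act Q := by
  constructor
  · intro h
    refine Reduction.eq_of_inv_eq fun i x hx Y hY => ?_
    rw [h i x hx Y hY, B.isRescaling_gradingGauge_act hQ R i x hx Y hY]
  · rintro rfl
    exact B.isRescaling_gradingGauge_act hQ R

lemma isHarmonic_gradingGauge_log_act {Q : Reduction B.PH D.HR} (hQ : Q.IsHarmonic D.𝔤 B.Φ 1)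
    {R : ℝ} (hR : 0 < R) :
    ((B.gradingGauge ((-Real.log R / 2 : ℝ) : ℂ)).act Q).IsHarmonic D.𝔤 B.Φ R := by
  refine B.isHarmonic_gradingGauge_act _ ?_ hQ
  rw [Complex.ofReal_re, mul_div_cancel₀ _ (two_ne_zero' ℝ), Real.exp_neg, Real.exp_log hR,
    mul_inv_cancel₀ hR.ne']

/-- If the reduction is invariant under `exp(ith₀)` for all real `t`, then `h₀` is imaginary. -/
lemma isImaginary_of_act_eq {Q : Reduction B.PH D.HR}
    (hQ : ∀ t : ℝ, (B.gradingGauge (t * Complex.I)).act Q = Q) : Q.IsImaginary B.h₀ := by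
  intro i x hx
  obtain ⟨a, -, hfib⟩ := Q.orbit i x hx
  have ha : a ∈ Q.fib i x := by rw [hfib]; exact ⟨1, D.HR.one_mem, by simp⟩
  -- In the frame `a` of `Q`, the group `exp(ith₀)` is unitary.
  have hunit : ∀ t : ℝ, expU ((t : ℂ) • (Complex.I • Ad a⁻¹ (B.h₀ i x))) ∈ unitaryGroup N := by
    intro t
    have h1 : expU ((t * Complex.I) • B.h₀ i x) * a ∈ Q.fib i x := by
      have h2 : expU ((t * Complex.I) • B.h₀ i x) * a ∈
          ((B.gradingGauge (t * Complex.I)).act Q).fib i x := ⟨a, ha, rfl⟩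
      rwa [hQ t] at h2
    rw [hfib] at h1
    obtain ⟨u, hu, h3⟩ := h1
    rw [smul_smul, ← Ad_smul, expU_Ad, inv_inv, mul_assoc, h3, inv_mul_cancel_left]
    exact D.HR_le_unitaryGroup hu
  have hskew := star_eq_neg_of_expU_mem_unitaryGroup hunit
  have hherm : star (Ad a⁻¹ (B.h₀ i x)) = Ad a⁻¹ (B.h₀ i x) := by
    have h1 := congrArg (Complex.I • ·) hskew
    simpa [star_smul, smul_smul] using h1
  rw [Q.inv_eq D.HR_le_unitaryGroup ha, rhoAt, hherm, Ad_neg, Ad_Ad_inv]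

/-- The gauge transformations `exp(ith₀)`, `t ∈ ℝ`, preserve the set of harmonic reductions with
parameter `1`, since they multiply `Φ₀` by scalars of absolute value `1`. -/
lemma isImaginary_of_unique {Q : Reduction B.PH D.HR} (hQ : Q.IsHarmonic D.𝔤 B.Φ 1)
    (huniq : ∀ Q' : Reduction B.PH D.HR, Q'.IsHarmonic D.𝔤 B.Φ 1 → Q' = Q) :
    Q.IsImaginary B.h₀ :=
  B.isImaginary_of_act_eq fun t => huniq _ (B.isHarmonic_gradingGauge_act _ (by simp) hQ)

lemma isHarmonic_iff_of_unique {Q : Reduction B.PH D.HR} (hQ : Q.IsHarmonic D.𝔤 B.Φ 1)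
    (huniq : ∀ Q' : Reduction B.PH D.HR, Q'.IsHarmonic D.𝔤 B.Φ 1 → Q' = Q)
    {R : ℝ} (hR : 0 < R) (Q' : Reduction B.PH D.HR) : Q'.IsHarmonic D.𝔤 B.Φ R ↔
      Q' = (B.gradingGauge ((-Real.log R / 2 : ℝ) : ℂ)).act Q := by
  constructor
  · intro h
    have h1 : ((B.gradingGauge ((Real.log R / 2 : ℝ) : ℂ)).act Q').IsHarmonic D.𝔤 B.Φ 1 := by
      refine B.isHarmonic_gradingGauge_act _ ?_ h
      rw [Complex.ofReal_re, mul_div_cancel₀ _ (two_ne_zero' ℝ), Real.exp_log hR, one_mul]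
    rw [← huniq _ h1, B.gradingGauge_act_act, ← Complex.ofReal_add, ← add_div, neg_add_cancel,
      zero_div, Complex.ofReal_zero, B.gradingGauge_zero_act]
  · rintro rfl
    exact B.isHarmonic_gradingGauge_log_act hQ hR

end CayleyUniformizing

end Grading

end CayleyHiggs

end

theorem proposition3p6 {N : ℕ} (D : CayleyGroups N)
    {X : Type*} [TopologicalSpace X] [T2Space X] [CompactSpace X] [ConnectedSpace X]
    [ChartedSpace ℂ X] [IsManifold 𝓘(ℂ) ω X]
    (𝔘 : CoordCover X) (B : CayleyUniformizing D 𝔘)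
    (Q₀ : Reduction B.PH D.HR) (hQ₀ : Q₀.IsHarmonic D.𝔤 B.Φ 1)
    (R : ℝ) (hR : 0 < R) :
    (Q₀.IsImaginary B.h₀ →
      ∃ Q₀R : Reduction B.PH D.HR,
        (∀ Q : Reduction B.PH D.HR, Q₀.IsRescaling Q D.𝔤 B.h₀ R ↔ Q = Q₀R) ∧
        Q₀R.IsHarmonic D.𝔤 B.Φ R) ∧
    ((∀ Q : Reduction B.PH D.HR, Q.IsHarmonic D.𝔤 B.Φ 1 → Q = Q₀) →
      Q₀.IsImaginary B.h₀ ∧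
      ∃ Q₀R : Reduction B.PH D.HR,
        (∀ Q : Reduction B.PH D.HR, Q₀.IsRescaling Q D.𝔤 B.h₀ R ↔ Q = Q₀R) ∧
        ∀ Q : Reduction B.PH D.HR, Q.IsHarmonic D.𝔤 B.Φ R ↔ Q = Q₀R) := by
  have hpart : Q₀.IsImaginary B.h₀ → _ := fun h => B.isRescaling_iff h R
  refine ⟨fun h => ⟨_, hpart h, B.isHarmonic_gradingGauge_log_act hQ₀ hR⟩, fun huniq => ?_⟩
  have h := B.isImaginary_of_unique hQ₀ huniq
  exact ⟨h, _, hpart h, B.isHarmonic_iff_of_unique hQ₀ huniq hR⟩
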